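/- Let $d\ge 2$ be an integer, let $K\subseteq\mathbb R^d$ be a convex body (a compact convex set with nonempty interior), and let $k$ be a positive integer with $k\le d(\ln d+\ln\ln d)$. A $k$-fold covering of $\mathbb R^d$ by translates of $K$ is a family $(x_i+K)_{i\in I}$, $x_i\in\mathbb R^d$ (repetitions allowed), such that every point of $\mathbb R^d$ lies in $x_i+K$ for at least $k$ indices $i$. The density of such a family is \[\limsup_{R\to\infty}\frac{1}{\operatorname{vol}(B(0,R))}\sum_{i\in I}\operatorname{vol}\big((x_i+K)\cap B(0,R)\big),\] where $B(0,R)$ is the Euclidean ball of radius $R$ centred at the origin, and $\vartheta^{(k)}(K)$ denotes the infimum of the densities of all $k$-fold coverings of $\mathbb R^d$ by translates of $K$. Then \[\vartheta^{(k)}(K)\le 6ed\,(3\ln d+\ln\ln d+15).\] -/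

import Mathlib

open MeasureTheory Filter
open scoped ENNReal Pointwise

/-- The translates `x i + K` (`i : ι`, repetitions allowed) form a `k`-fold covering of `ℝ^d`:
every point lies in at least `k` of them, counted with multiplicity. -/
def IsKFoldCovering {d : ℕ} (k : ℕ) (K : Set (EuclideanSpace ℝ (Fin d))) {ι : Type}
    (x : ι → EuclideanSpace ℝ (Fin d)) : Prop :=
  ∀ p : EuclideanSpace ℝ (Fin d), (k : ℕ∞) ≤ {i : ι | p ∈ x i +ᵥ K}.encard

/-- The (upper) density of the family of translates `x i + K`: the upper limit, as `R → ∞`, of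
`(∑ i, vol ((x i + K) ∩ B(0, R))) / vol B(0, R)`. -/
noncomputable def translatesDensity {d : ℕ} (K : Set (EuclideanSpace ℝ (Fin d))) {ι : Type}
    (x : ι → EuclideanSpace ℝ (Fin d)) : ℝ≥0∞ :=
  limsup (fun R : ℝ =>
    (∑' i, volume ((x i +ᵥ K) ∩ Metric.closedBall (0 : EuclideanSpace ℝ (Fin d)) R)) /
      volume (Metric.closedBall (0 : EuclideanSpace ℝ (Fin d)) R)) atTop

/-- The `k`-fold translative covering density `ϑ^(k)(K)`: the infimum of the densities of the
`k`-fold coverings of `ℝ^d` by translates of `K`. Since it is built from upper densities, it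
bounds from above the variant built from lower densities. -/
noncomputable def kFoldCoveringDensity {d : ℕ} (k : ℕ) (K : Set (EuclideanSpace ℝ (Fin d))) :
    ℝ≥0∞ :=
  sInf {δ : ℝ≥0∞ | ∃ (ι : Type) (x : ι → EuclideanSpace ℝ (Fin d)),
    IsKFoldCovering k K x ∧ translatesDensity K x = δ}

/-- Among the translates `x + A` of a subset of a finite abelian group one can choose `N` greedily
so that the weights `(1/2) ^ (multiplicity of h)` have small sum. -/
theorem exists_translates_sum_prod_le {G : Type*} [AddCommGroup G] [Fintype G] [DecidableEq G]
    (A : Finset G) (N : ℕ) :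
    ∃ g : Fin N → G, ∑ h, ∏ j, (if h - g j ∈ A then (1 / 2 : ℝ) else 1) ≤
      Fintype.card G * (1 - A.card / (2 * Fintype.card G) : ℝ) ^ N := by
  have hG : (0 : ℝ) < Fintype.card G := by exact_mod_cast Fintype.card_pos
  induction N with
  | zero => exact ⟨Fin.elim0, by simp⟩
  | succ N ih =>
    obtain ⟨g, hg⟩ := ih
    set w : G → ℝ := fun h => ∏ j, (if h - g j ∈ A then (1 / 2 : ℝ) else 1) with hw
    have key : ∀ h : G, ∑ x, (if h - x ∈ A then (1 / 2 : ℝ) else 1) =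
        Fintype.card G * (1 - A.card / (2 * Fintype.card G) : ℝ) := by
      intro h
      have hcomp := (Equiv.subLeft h).sum_comp (fun x => if x ∈ A then (1 / 2 : ℝ) else 1)
      simp only [Equiv.subLeft_apply] at hcomp
      rw [hcomp]
      have : ∀ x, (if x ∈ A then (1 / 2 : ℝ) else 1) = 1 - (if x ∈ A then (1 / 2 : ℝ) else 0) := by
        intro x; split_ifs <;> norm_num
      simp only [this, Finset.sum_sub_distrib, Finset.sum_ite_mem, Finset.sum_const,
        Finset.univ_inter, Finset.card_univ, nsmul_eq_mul]
      field_simp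
    have hsum : ∑ x, ∑ h, (if h - x ∈ A then (1 / 2 : ℝ) else 1) * w h =
        ∑ _x : G, (1 - A.card / (2 * Fintype.card G) : ℝ) * ∑ h, w h := by
      rw [Finset.sum_comm]
      simp only [← Finset.sum_mul, key, Finset.sum_const, Finset.card_univ, nsmul_eq_mul]
      rw [← Finset.mul_sum, mul_assoc]
    obtain ⟨x, -, hx⟩ := Finset.exists_le_of_sum_le Finset.univ_nonempty hsum.le
    refine ⟨Fin.cons x g, ?_⟩
    simp only [Fin.prod_univ_succ, Fin.cons_zero, Fin.cons_succ]
    refine hx.trans ?_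
    rw [pow_succ', mul_left_comm]
    refine mul_le_mul_of_nonneg_left hg ?_
    rw [sub_nonneg, div_le_one (by positivity)]
    have : (A.card : ℝ) ≤ Fintype.card G := by exact_mod_cast A.card_le_univ
    linarith

/-- Sufficiently many well-chosen translates of a subset cover a finite abelian group
`k`-fold. -/
theorem exists_translates_kFold_cover {G : Type*} [AddCommGroup G] [Fintype G] [DecidableEq G]
    (A : Finset G) (N k : ℕ)
    (h : Real.log (Fintype.card G) + k * Real.log 2 < N * (A.card / (2 * Fintype.card G) : ℝ)) :
    ∃ g : Fin N → G, ∀ h : G, k ≤ (Finset.univ.filter fun j => h - g j ∈ A).card := by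
  have hG : (0 : ℝ) < Fintype.card G := by exact_mod_cast Fintype.card_pos
  obtain ⟨g, hg⟩ := exists_translates_sum_prod_le A N
  refine ⟨g, fun y => ?_⟩
  by_contra! hlt
  have h1 : (1 / 2 : ℝ) ^ k ≤ ∏ j, (if y - g j ∈ A then (1 / 2 : ℝ) else 1) := by
    rw [Finset.prod_ite]
    simp only [Finset.prod_const, one_pow, mul_one]
    exact pow_le_pow_of_le_one (by norm_num) (by norm_num) hlt.le
  have h2 : (∏ j, (if y - g j ∈ A then (1 / 2 : ℝ) else 1)) ≤
      ∑ h, ∏ j, (if h - g j ∈ A then (1 / 2 : ℝ) else 1) :=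
    Finset.single_le_sum (f := fun h => ∏ j, (if h - g j ∈ A then (1 / 2 : ℝ) else 1))
      (fun h _ => Finset.prod_nonneg fun j _ => by split_ifs <;> norm_num) (Finset.mem_univ y)
  set a : ℝ := A.card / (2 * Fintype.card G) with ha
  have ha1 : 0 ≤ 1 - a := by
    rw [sub_nonneg, ha, div_le_one (by positivity)]
    have : (A.card : ℝ) ≤ Fintype.card G := by exact_mod_cast A.card_le_univ
    linarith
  have h3 : (1 - a) ^ N ≤ Real.exp (-(N * a)) := by
    rw [← mul_neg, Real.exp_nat_mul]
    exact pow_le_pow_left₀ ha1 (Real.one_sub_le_exp_neg a) N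
  have h4 : (Fintype.card G : ℝ) * Real.exp (-(N * a)) < (1 / 2 : ℝ) ^ k := by
    nth_rewrite 1 [← Real.exp_log hG]
    rw [← Real.exp_add]
    have : (1 / 2 : ℝ) ^ k = Real.exp (-(k * Real.log 2)) := by
      rw [← mul_neg, Real.exp_nat_mul, Real.exp_neg, Real.exp_log two_pos, one_div]
    rw [this]
    exact Real.exp_lt_exp.2 (by linarith)
  have := mul_le_mul_of_nonneg_left h3 hG.le
  linarith

/-- A convex body contains a simplex of maximal volume; in the coordinates given by its edges at
one vertex, the body lies in the cube `[-1, 1] ^ d`. -/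
theorem exists_basis_simplex_subset_coords_le {d : ℕ} {K : Set (EuclideanSpace ℝ (Fin d))}
    (hc : IsCompact K) (hconv : Convex ℝ K) (hi : (interior K).Nonempty) :
    ∃ (b : Module.Basis (Fin d) ℝ (EuclideanSpace ℝ (Fin d))) (p : EuclideanSpace ℝ (Fin d)),
      (∀ x ∈ K, ∀ i, |b.repr (x - p) i| ≤ 1) ∧
      ∀ t : Fin d → ℝ, (∀ i, 0 ≤ t i) → ∑ i, t i ≤ 1 → p + ∑ i, t i • b i ∈ K := by
  set e : Module.Basis (Fin d) ℝ (EuclideanSpace ℝ (Fin d)) :=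
    (EuclideanSpace.basisFun (Fin d) ℝ).toBasis with he
  set f : EuclideanSpace ℝ (Fin d) × (Fin d → EuclideanSpace ℝ (Fin d)) → ℝ :=
    fun P => |e.det fun i => P.2 i - P.1| with hf
  have hfc : Continuous f := by
    refine continuous_abs.comp ?_
    simp only [Module.Basis.det_apply]
    refine Continuous.matrix_det (continuous_matrix fun i j => ?_)
    have hsub : Continuous fun P : EuclideanSpace ℝ (Fin d) × (Fin d → EuclideanSpace ℝ (Fin d)) =>
      P.2 j - P.1 := by fun_prop
    exact (LinearMap.continuous_of_finiteDimensional (e.coord i)).comp hsub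
  obtain ⟨c, hcK⟩ := hi
  have hcomp : IsCompact (K ×ˢ (Set.univ.pi fun _ : Fin d => K)) :=
    hc.prod (isCompact_univ_pi fun _ => hc)
  have hcK' := interior_subset hcK
  obtain ⟨⟨p, v⟩, hpv, hmax⟩ := hcomp.exists_isMaxOn ⟨(c, fun _ => c), by simp [hcK']⟩
    hfc.continuousOn
  simp only [Set.mem_prod, Set.mem_univ_pi] at hpv
  obtain ⟨hp, hv⟩ := hpv
  obtain ⟨ε, hε, hball⟩ := Metric.isOpen_iff.1 isOpen_interior c hcK
  have hpos : 0 < f (p, v) := by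
    have h1 : f (c, fun i => c + (ε / 2) • e i) ≤ f (p, v) := by
      refine hmax ⟨hcK', fun i _ => interior_subset (hball ?_)⟩
      simp only [he, Metric.mem_ball, dist_self_add_left, norm_smul, OrthonormalBasis.coe_toBasis,
        OrthonormalBasis.norm_eq_one]
      rw [Real.norm_of_nonneg (by positivity)]
      linarith
    refine lt_of_lt_of_le ?_ h1
    simp only [hf, add_sub_cancel_left]
    rw [abs_pos, AlternatingMap.map_smul_univ, e.det_self]
    simp [hε.ne']
  have hne : e.det (fun i => v i - p) ≠ 0 := abs_pos.1 hpos
  have hb := (Module.Basis.is_basis_iff_det e (v := fun i => v i - p)).2 hne.isUnit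
  set b := Module.Basis.mk hb.1 hb.2.ge with hbdef
  have hbi : ∀ i, b i = v i - p := fun i => by simp [hbdef]
  refine ⟨b, p, fun x hx i => ?_, fun t ht hts => ?_⟩
  · have h1 := congrArg (fun l => l (x - p)) (e.det_smul_mk_coord_eq_det_update hb.1 hb.2.ge i)
    simp only [LinearMap.smul_apply, smul_eq_mul] at h1
    have h2 : f (p, Function.update v i x) ≤ f (p, v) := by
      refine hmax ⟨hp, fun j _ => ?_⟩
      by_cases hj : j = i
      · subst hj; simpa using hx
      · simpa [hj] using hv j
    have h3 : (fun j => Function.update v i x j - p) =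
        Function.update (fun j => v j - p) i (x - p) := by
      ext1 j
      by_cases hj : j = i
      · subst hj; simp
      · simp [hj]
    simp only [hf, h3] at h2
    have h4 : e.det (fun i => v i - p) * b.repr (x - p) i =
      e.det (Function.update (fun j => v j - p) i (x - p)) := h1
    rw [← h4, abs_mul] at h2
    have h5 : 0 < |e.det (fun i => v i - p)| := hpos
    nlinarith
  · have h1 := hconv.sum_mem (t := Finset.univ) (w := fun o : Option (Fin d) =>
      o.elim (1 - ∑ i, t i) t) (z := fun o => o.elim p v) ?_ ?_ ?_
    · rw [Fintype.sum_option] at h1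
      simp only [Option.elim_none, Option.elim_some] at h1
      convert h1 using 1
      simp only [hbi, smul_sub, Finset.sum_sub_distrib, sub_smul, one_smul, Finset.sum_smul]
      abel
    · rintro (_ | i) _
      · simpa using hts
      · exact ht i
    · rw [Fintype.sum_option]; simp
    · rintro (_ | i) _
      · exact hp
      · exact hv i

/-- In suitable coordinates centred in a convex body, the body contains the cube `[-2d, 2d] ^ d`
and lies in a cube of side `8 d ^ 2`. -/
theorem exists_basis_cube_subset_coords_mem {d : ℕ} (hd : 1 ≤ d)
    {K : Set (EuclideanSpace ℝ (Fin d))}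
    (hc : IsCompact K) (hconv : Convex ℝ K) (hi : (interior K).Nonempty) :
    ∃ (b : Module.Basis (Fin d) ℝ (EuclideanSpace ℝ (Fin d))) (q : EuclideanSpace ℝ (Fin d)),
      (∀ x ∈ K, ∀ i, b.repr (x - q) i ∈
        Set.Icc (-(4 * d ^ 2 + 2 * d) : ℝ) (4 * d ^ 2 - 2 * d)) ∧
      ∀ t : Fin d → ℝ, (∀ i, |t i| ≤ 2 * d) → q + ∑ i, t i • b i ∈ K := by
  obtain ⟨b, p, h1, h2⟩ := exists_basis_simplex_subset_coords_le hc hconv hi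
  have hd' : (0 : ℝ) < d := by exact_mod_cast hd
  set s : ℝ := (4 * d ^ 2 : ℝ)⁻¹ with hs
  have hs0 : 0 < s := by positivity
  have hs1 : s * (4 * d ^ 2) = 1 := inv_mul_cancel₀ (by positivity)
  set u : Fin d → ℝˣ := fun _ => Units.mk0 s hs0.ne' with hu
  have hbu : ∀ i, b.unitsSMul u i = s • b i := fun i => by
    rw [Module.Basis.unitsSMul_apply]; rfl
  refine ⟨b.unitsSMul u, p + ∑ i, (2 * d : ℝ) • b.unitsSMul u i, fun x hx i => ?_, fun t ht => ?_⟩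
  · have h3 : (b.unitsSMul u).repr (x - (p + ∑ i, (2 * d : ℝ) • b.unitsSMul u i)) i =
        (4 * d ^ 2) * b.repr (x - p) i - 2 * d := by
      rw [← sub_sub, map_sub, Finsupp.sub_apply, Module.Basis.repr_unitsSMul,
        Module.Basis.repr_sum_self]
      congr 1
      simp [hu, hs, Units.smul_def]
    rw [h3]
    have h4 := abs_le.1 (h1 x hx i)
    have h5 : (0 : ℝ) < 4 * d ^ 2 := by positivity
    constructor <;> nlinarith
  · have h3 := h2 (fun i => (2 * d + t i) * s) (fun i => mul_nonneg ?_ hs0.le) ?_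
    · convert h3 using 1
      simp only [hbu, add_assoc, ← Finset.sum_add_distrib, smul_smul, ← add_smul, add_mul]
    · have := abs_le.1 (ht i); linarith
    · calc ∑ i, (2 * d + t i) * s ≤ ∑ _i : Fin d, (4 * d) * s := by
            refine Finset.sum_le_sum fun i _ => mul_le_mul_of_nonneg_right ?_ hs0.le
            have := abs_le.1 (ht i); linarith
        _ = 1 := by
            rw [Finset.sum_const, Finset.card_univ, Fintype.card_fin, nsmul_eq_mul, ← hs1]; ring

/-- The density of finitely many translates of a lattice arrangement of a compact set. -/
theorem translatesDensity_le_of_periodic {d N : ℕ} {K : Set (EuclideanSpace ℝ (Fin d))}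
    (hK : IsCompact K) (c : Module.Basis (Fin d) ℝ (EuclideanSpace ℝ (Fin d)))
    (u : Fin N → EuclideanSpace ℝ (Fin d)) :
    translatesDensity K
        (fun j : Fin N × (Fin d → ℤ) => u j.1 + ∑ i, (j.2 i : ℝ) • c i) ≤
      N * volume K / volume (ZSpan.fundamentalDomain c) := by
  set F := ZSpan.fundamentalDomain c with hF
  have hFm : MeasurableSet F := ZSpan.fundamentalDomain_measurableSet c
  obtain ⟨D₁, hD₁⟩ := (ZSpan.fundamentalDomain_isBounded c).subset_closedBall 0
  obtain ⟨D₂, hD₂⟩ := hK.isBounded.subset_closedBall 0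
  set D := max (D₁ + D₂) 0 with hD
  have hF0 : volume F ≠ 0 := ZSpan.measure_fundamentalDomain_ne_zero c
  have hFtop : volume F ≠ ∞ := (ZSpan.fundamentalDomain_isBounded c).measure_lt_top.ne
  set B : ℝ → Set (EuclideanSpace ℝ (Fin d)) := fun R => Metric.closedBall 0 R with hB
  have hone : ∀ (R : ℝ) (v : EuclideanSpace ℝ (Fin d)),
      (∑' l : Fin d → ℤ, volume (((v + ∑ i, (l i : ℝ) • c i) +ᵥ K) ∩ B R)) * volume F ≤
        volume K * volume (B (R + D)) := by
    intro R v
    set x : (Fin d → ℤ) → EuclideanSpace ℝ (Fin d) := fun l => v + ∑ i, (l i : ℝ) • c i with hx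
    have hterm : ∀ l, volume ((x l +ᵥ K) ∩ B R) * volume F ≤
        volume K * volume ((x l +ᵥ F) ∩ B (R + D)) := by
      intro l
      rcases ((x l +ᵥ K) ∩ B R).eq_empty_or_nonempty with h | ⟨y, hy, hyR⟩
      · simp [h]
      · have hsub : x l +ᵥ F ⊆ B (R + D) := by
          rintro _ ⟨f, hf, rfl⟩
          obtain ⟨κ, hκ, rfl⟩ := hy
          have h1 := mem_closedBall_zero_iff.1 (hD₁ hf)
          have h2 := mem_closedBall_zero_iff.1 (hD₂ hκ)
          have h3 := mem_closedBall_zero_iff.1 hyR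
          refine mem_closedBall_zero_iff.2 ?_
          simp only [vadd_eq_add] at h3 ⊢
          have h4 : x l + f = (x l + κ) - κ + f := by abel
          have h5 := norm_add_le ((x l + κ) - κ) f
          have h6 := norm_sub_le (x l + κ) κ
          rw [h4]
          linarith [le_max_left (D₁ + D₂) 0]
        rw [Set.inter_eq_left.2 hsub, measure_vadd]
        refine mul_le_mul_left ?_ _
        exact (measure_mono Set.inter_subset_left).trans_eq (measure_vadd volume (x l) K)
    have hdisj : Pairwise (Function.onFun Disjoint fun l => (x l +ᵥ F) ∩ B (R + D)) := by
      intro l l' hll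
      refine Set.disjoint_left.2 ?_
      rintro y ⟨⟨f, hf, rfl⟩, -⟩ ⟨⟨f', hf', h⟩, -⟩
      refine hll (funext fun i => ?_)
      have h1 := congrArg (fun y => c.repr (y - v) i) h
      simp only [hx, vadd_eq_add, add_assoc, add_sub_cancel_left, map_add, Finsupp.add_apply,
        Module.Basis.repr_sum_self] at h1
      have h2 := hf i
      have h3 := hf' i
      have h4 : (l i : ℝ) < l' i + 1 := by linarith [h2.1, h3.2]
      have h5 : (l' i : ℝ) < l i + 1 := by linarith [h2.2, h3.1]
      have h6 : l i < l' i + 1 := by exact_mod_cast h4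
      have h7 : l' i < l i + 1 := by exact_mod_cast h5
      omega
    calc (∑' l, volume ((x l +ᵥ K) ∩ B R)) * volume F
        = ∑' l, volume ((x l +ᵥ K) ∩ B R) * volume F := ENNReal.tsum_mul_right.symm
      _ ≤ ∑' l, volume K * volume ((x l +ᵥ F) ∩ B (R + D)) := ENNReal.tsum_le_tsum hterm
      _ = volume K * ∑' l, volume ((x l +ᵥ F) ∩ B (R + D)) := ENNReal.tsum_mul_left
      _ = volume K * volume (⋃ l, (x l +ᵥ F) ∩ B (R + D)) := by
          rw [measure_iUnion hdisj fun l => (hFm.const_vadd _).inter measurableSet_closedBall]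
      _ ≤ volume K * volume (B (R + D)) := by
          gcongr
          exact Set.iUnion_subset fun l => Set.inter_subset_right
  have hall : ∀ R : ℝ, (∑' j : Fin N × (Fin d → ℤ),
      volume (((u j.1 + ∑ i, (j.2 i : ℝ) • c i) +ᵥ K) ∩ B R)) ≤
        N * volume K / volume F * volume (B (R + D)) := by
    intro R
    rw [ENNReal.tsum_prod (f := fun (j : Fin N) (l : Fin d → ℤ) =>
      volume (((u j + ∑ i, (l i : ℝ) • c i) +ᵥ K) ∩ B R)), tsum_fintype]
    calc _ ≤ ∑ _j : Fin N, volume K * volume (B (R + D)) / volume F :=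
          Finset.sum_le_sum fun j _ =>
            (ENNReal.le_div_iff_mul_le (.inl hF0) (.inl hFtop)).2 (hone R (u j))
      _ = _ := by
          rw [Finset.sum_const, Finset.card_univ, Fintype.card_fin, nsmul_eq_mul]
          simp only [div_eq_mul_inv]
          ring
  have hratio : ∀ R : ℝ, 0 < R →
      volume (B (R + D)) / volume (B R) = ENNReal.ofReal ((1 + D / R) ^ d) := by
    intro R hR
    have hpos : 0 < volume (B R) := Metric.measure_closedBall_pos _ _ hR
    have hfin : volume (B R) ≠ ∞ := measure_closedBall_lt_top.ne
    have h1 : R + D = (1 + D / R) * R := by field_simp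
    rw [h1]
    have := Measure.addHaar_closedBall_mul volume (0 : EuclideanSpace ℝ (Fin d))
      (r := 1 + D / R) (by positivity) hR.le
    rw [finrank_euclideanSpace_fin] at this
    simp only [hB]
    rw [this, ENNReal.mul_div_cancel_right hpos.ne' hfin]
  have hlim : Tendsto (fun R : ℝ => N * volume K / volume F * ENNReal.ofReal ((1 + D / R) ^ d))
      atTop (nhds (N * volume K / volume F * ENNReal.ofReal ((1 + 0) ^ d))) := by
    refine ENNReal.Tendsto.const_mul (ENNReal.tendsto_ofReal ?_) (.inl (by simp))
    exact (tendsto_const_nhds.add (tendsto_const_nhds.div_atTop tendsto_id)).pow d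
  have hle := limsup_le_limsup (f := atTop) (u := fun R : ℝ => (∑' j : Fin N × (Fin d → ℤ),
      volume (((u j.1 + ∑ i, (j.2 i : ℝ) • c i) +ᵥ K) ∩ B R)) / volume (B R))
      (v := fun R => N * volume K / volume F * ENNReal.ofReal ((1 + D / R) ^ d)) <| by
    filter_upwards [eventually_gt_atTop 0] with R hR
    rw [← hratio R hR, ← mul_div_assoc]
    exact ENNReal.div_le_div_right (hall R) _
  rw [hlim.limsup_eq] at hle
  simpa only [add_zero, one_pow, ENNReal.ofReal_one, mul_one] using! hle

/-- Scaling a basis by `n` multiplies the volume of its fundamental domain by `n ^ d`. -/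
theorem volume_fundamentalDomain_unitsSMul_const {d : ℕ}
    (b : Module.Basis (Fin d) ℝ (EuclideanSpace ℝ (Fin d))) (r : ℝˣ) (hr : 0 < (r : ℝ)) :
    volume (ZSpan.fundamentalDomain (b.unitsSMul fun _ => r)) =
      ENNReal.ofReal ((r : ℝ) ^ d) * volume (ZSpan.fundamentalDomain b) := by
  have h : ZSpan.fundamentalDomain (b.unitsSMul fun _ => r) =
      (r : ℝ) • ZSpan.fundamentalDomain b := by
    ext y
    rw [Set.mem_smul_set_iff_inv_smul_mem₀ hr.ne']
    simp [ZSpan.mem_fundamentalDomain, Module.Basis.repr_unitsSMul, Units.smul_def]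
  rw [h, Measure.addHaar_smul_of_nonneg _ hr.le, finrank_euclideanSpace_fin]

/-- The grid cells contained in a convex body that contains a large cube carry at least half of
its volume. -/
theorem volume_le_two_mul_card_mul_volume_cell {d : ℕ} (hd : 1 ≤ d)
    {K : Set (EuclideanSpace ℝ (Fin d))} (hconv : Convex ℝ K)
    (b : Module.Basis (Fin d) ℝ (EuclideanSpace ℝ (Fin d))) (q : EuclideanSpace ℝ (Fin d))
    (hcube : ∀ t : Fin d → ℝ, (∀ i, |t i| ≤ 2 * d) → q + ∑ i, t i • b i ∈ K)
    (A : Finset (Fin d → ℤ))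
    (hA : ∀ z : Fin d → ℤ, (∀ s : Fin d → ℝ, (∀ i, s i ∈ Set.Icc (0 : ℝ) 1) →
      q + ∑ i, ((z i : ℝ) + s i) • b i ∈ K) → z ∈ A) :
    volume K ≤ 2 * A.card * volume (ZSpan.fundamentalDomain b) := by
  have hd' : (1 : ℝ) ≤ d := by exact_mod_cast hd
  set δ : ℝ := (2 * d : ℝ)⁻¹ with hδ
  have hδ0 : 0 < δ := by positivity
  have hδd : δ * (2 * d) = 1 := inv_mul_cancel₀ (by positivity)
  have hδ1 : δ ≤ 1 / 2 := by nlinarith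
  have hsub : AffineMap.homothety q (1 - δ) '' K ⊆
      ⋃ z ∈ A, ((q + ∑ i, (z i : ℝ) • b i) +ᵥ ZSpan.fundamentalDomain b) := by
    rintro _ ⟨x, hx, rfl⟩
    set w : Fin d → ℝ := fun i => (1 - δ) * b.repr (x - q) i with hw
    have hwx : ∑ i, w i • b i = (1 - δ) • (x - q) := by
      simp only [hw, mul_smul, ← Finset.smul_sum, b.sum_repr]
    have hyx : AffineMap.homothety q (1 - δ) x = q + ∑ i, w i • b i := by
      rw [hwx, AffineMap.homothety_apply, vsub_eq_sub, vadd_eq_add, add_comm]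
    rw [hyx]
    simp only [Set.mem_iUnion]
    refine ⟨fun i => ⌊w i⌋, hA _ fun s hs => ?_, ∑ i, Int.fract (w i) • b i, fun i => ?_, ?_⟩
    · have h1 := hcube (fun i => (2 * d) * (s i - Int.fract (w i))) fun i => by
        rw [abs_mul, abs_of_nonneg (by positivity : (0 : ℝ) ≤ 2 * d)]
        refine mul_le_of_le_one_right (by positivity) (abs_le.2 ?_)
        have := hs i
        have h2 := Int.fract_nonneg (w i)
        have h3 := (Int.fract_lt_one (w i)).le
        constructor <;> linarith [this.1, this.2]
      have h2 := hconv hx h1 (a := 1 - δ) (b := δ) (by linarith) hδ0.le (by ring)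
      convert h2 using 1
      have h3 : (1 - δ) • x = (1 - δ) • q + ∑ i, w i • b i := by
        rw [hwx, smul_sub]; abel
      rw [h3, smul_add, Finset.smul_sum]
      simp only [smul_smul, ← mul_assoc, hδd, one_mul]
      have h4 : (1 - δ) • q + ∑ i, w i • b i + (δ • q + ∑ i, (s i - Int.fract (w i)) • b i) =
          q + ∑ i, (w i + (s i - Int.fract (w i))) • b i := by
        simp only [add_smul _ _ (b _), Finset.sum_add_distrib, sub_smul 1 δ q, one_smul]
        abel
      rw [h4]
      congr 1
      refine Finset.sum_congr rfl fun i _ => ?_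
      congr 1
      linarith [Int.floor_add_fract (w i)]
    · rw [Module.Basis.repr_sum_self]
      exact ⟨Int.fract_nonneg _, Int.fract_lt_one _⟩
    · simp only [vadd_eq_add, add_assoc, ← Finset.sum_add_distrib, ← add_smul,
        Int.floor_add_fract]
  have hvol := (measure_mono (μ := volume) hsub).trans (measure_biUnion_finset_le _ _)
  simp only [measure_vadd, Finset.sum_const, nsmul_eq_mul, Measure.addHaar_image_homothety,
    finrank_euclideanSpace_fin] at hvol
  have hhalf : (1 / 2 : ℝ) ≤ |(1 - δ) ^ d| := by
    have := one_add_mul_le_pow (a := -δ) (by linarith) d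
    refine le_trans ?_ (le_abs_self _)
    rw [sub_eq_add_neg]
    refine le_trans ?_ this
    linarith
  have h2 : ENNReal.ofReal (1 / 2) * volume K ≤ A.card * volume (ZSpan.fundamentalDomain b) :=
    (mul_le_mul_left (ENNReal.ofReal_le_ofReal hhalf) _).trans hvol
  calc volume K = 2 * (ENNReal.ofReal (1 / 2) * volume K) := by
        rw [← mul_assoc]
        have : (2 : ℝ≥0∞) * ENNReal.ofReal (1 / 2) = 1 := by
          rw [← ENNReal.ofReal_ofNat 2, ← ENNReal.ofReal_mul (by norm_num)]
          norm_num
        rw [this, one_mul]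
    _ ≤ 2 * (A.card * volume (ZSpan.fundamentalDomain b)) := by gcongr
    _ = _ := by rw [mul_assoc]

/-- If the grid cells indexed by `A` lie in `q`-centred coordinates inside `K`, then a `k`-fold
cover of the discrete torus by translates of `A` induces a periodic `k`-fold covering of space by
translates of `K`. -/
theorem isKFoldCovering_of_torus_cover {d n N k : ℕ}
    {K : Set (EuclideanSpace ℝ (Fin d))}
    (b : Module.Basis (Fin d) ℝ (EuclideanSpace ℝ (Fin d))) (q : EuclideanSpace ℝ (Fin d))
    (A : Set (Fin d → ℤ))
    (hA : ∀ z ∈ A, ∀ s : Fin d → ℝ, (∀ i, s i ∈ Set.Icc (0 : ℝ) 1) →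
      q + ∑ i, ((z i : ℝ) + s i) • b i ∈ K)
    (g : Fin N → Fin d → ℤ)
    (hg : ∀ h : Fin d → ℤ, ∃ S : Finset (Fin N), k ≤ S.card ∧
      ∀ j ∈ S, ∃ z ∈ A, ∀ i, (n : ℤ) ∣ h i - g j i - z i) :
    IsKFoldCovering k K fun j : Fin N × (Fin d → ℤ) =>
      (∑ i, (g j.1 i : ℝ) • b i) + ∑ i, (j.2 i : ℝ) • ((n : ℝ) • b i) := by
  intro p
  set w : Fin d → ℝ := fun i => b.repr (p - q) i with hw
  have hp : p = q + ∑ i, w i • b i := by simp only [hw, b.sum_repr, add_sub_cancel]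
  obtain ⟨S, hkS, hS⟩ := hg fun i => ⌊w i⌋
  have hex : ∀ j ∈ S, ∃ l : Fin d → ℤ, p ∈
      ((∑ i, (g j i : ℝ) • b i) + ∑ i, (l i : ℝ) • ((n : ℝ) • b i)) +ᵥ K := by
    intro j hj
    obtain ⟨z, hz, hdvd⟩ := hS j hj
    choose l hl using hdvd
    refine ⟨l, _, hA z hz (fun i => Int.fract (w i)) fun i =>
      ⟨Int.fract_nonneg _, (Int.fract_lt_one _).le⟩, ?_⟩
    simp only [vadd_eq_add]
    rw [hp, add_left_comm]
    congr 1
    simp only [smul_smul, ← Finset.sum_add_distrib, ← add_smul]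
    refine Finset.sum_congr rfl fun i _ => ?_
    congr 1
    have h1 : (⌊w i⌋ : ℝ) - g j i - z i = n * l i := by exact_mod_cast hl i
    linarith [Int.floor_add_fract (w i)]
  choose! l hl using hex
  have hinj : Function.Injective fun j : Fin N => (j, l j) := fun j j' h => congrArg Prod.fst h
  calc (k : ℕ∞) ≤ S.card := by exact_mod_cast hkS
    _ = ((fun j : Fin N => (j, l j)) '' (S : Set (Fin N))).encard := by
        rw [hinj.encard_image, Set.encard_coe_eq_coe_finsetCard]
    _ ≤ _ := by
        refine Set.encard_le_encard ?_
        rintro _ ⟨j, hj, rfl⟩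
        exact hl j hj

/-- The `k`-fold covering density of a convex body is bounded by the density of a `k`-fold
covering that is periodic with respect to a discrete torus of `(8 d ^ 2) ^ d` cells. -/
theorem kFoldCoveringDensity_le_log_card_torus {d : ℕ} (hd : 1 ≤ d)
    {K : Set (EuclideanSpace ℝ (Fin d))}
    (hc : IsCompact K) (hconv : Convex ℝ K) (hi : (interior K).Nonempty) (k : ℕ) :
    kFoldCoveringDensity k K ≤
      ENNReal.ofReal (4 * (d * Real.log (8 * d ^ 2) + k * Real.log 2) + 2) := by
  classical
  obtain ⟨b, q, hbox, hcube⟩ := exists_basis_cube_subset_coords_mem hd hc hconv hi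
  set n : ℕ := 8 * d ^ 2 with hn
  have hn0 : 0 < n := by positivity
  have : NeZero n := ⟨hn0.ne'⟩
  set P : (Fin d → ℤ) → Prop := fun z => ∀ s : Fin d → ℝ, (∀ i, s i ∈ Set.Icc (0 : ℝ) 1) →
      q + ∑ i, ((z i : ℝ) + s i) • b i ∈ K with hP
  have hPbox : ∀ z, P z → ∀ i, z i ∈
      Set.Ico (-(4 * (d : ℤ) ^ 2 + 2 * d)) (4 * (d : ℤ) ^ 2 - 2 * d) := by
    intro z hz i
    have h0 := hbox _ (hz (fun _ => 0) fun _ => by simp) i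
    have h1 := hbox _ (hz (fun _ => 1) fun _ => by simp) i
    rw [add_sub_cancel_left, Module.Basis.repr_sum_self] at h0 h1
    constructor
    · have := h0.1
      rw [add_zero] at this
      exact_mod_cast this
    · have := h1.2
      refine Int.lt_of_add_one_le ?_
      exact_mod_cast this
  set A : Finset (Fin d → ℤ) := (Fintype.piFinset fun _ : Fin d =>
    Finset.Ico (-(4 * (d : ℤ) ^ 2 + 2 * d)) (4 * (d : ℤ) ^ 2 - 2 * d)).filter P with hAdef
  have hAP : ∀ z, z ∈ A ↔ P z := by
    intro z
    simp only [hAdef, Finset.mem_filter, Fintype.mem_piFinset, Finset.mem_Ico, and_iff_right_iff_imp]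
    exact fun hz i => hPbox z hz i
  set red : (Fin d → ℤ) → Fin d → ZMod n := fun z i => (z i : ZMod n) with hred
  have hinj : Set.InjOn red A := by
    intro z hz z' hz' h
    funext i
    have h1 := hPbox z ((hAP z).1 hz) i
    have h2 := hPbox z' ((hAP z').1 hz') i
    have h3 := (ZMod.intCast_eq_intCast_iff_dvd_sub _ _ _).1 (congrFun h i)
    have h4 : |z' i - z i| < n := by
      rw [hn, abs_lt]; push_cast
      constructor <;> linarith [h1.1, h1.2, h2.1, h2.2]
    have := Int.eq_zero_of_abs_lt_dvd h3 h4
    omega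
  have hcard : (A.image red).card = A.card := Finset.card_image_of_injOn hinj
  have hG : (Fintype.card (Fin d → ZMod n) : ℝ) = (n : ℝ) ^ d := by
    simp [ZMod.card]
  have hvol := volume_le_two_mul_card_mul_volume_cell hd hconv b q hcube A
    fun z hz => (hAP z).2 hz
  have hC0 : volume (ZSpan.fundamentalDomain b) ≠ 0 := ZSpan.measure_fundamentalDomain_ne_zero b
  have hCtop : volume (ZSpan.fundamentalDomain b) ≠ ∞ :=
    (ZSpan.fundamentalDomain_isBounded b).measure_lt_top.ne
  have hApos : 0 < A.card := by
    rw [Nat.pos_iff_ne_zero]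
    intro h
    rw [h] at hvol
    have h1 : 0 < volume K := (isOpen_interior.measure_pos volume hi).trans_le
      (measure_mono interior_subset)
    simp at hvol
    exact h1.ne' hvol
  set G : ℝ := (n : ℝ) ^ d with hGdef
  have hGpos : 0 < G := by positivity
  set α : ℝ := A.card / (2 * G) with hα
  have hα0 : 0 < α := by positivity
  have hα1 : α ≤ 1 / 2 := by
    rw [hα, div_le_div_iff₀ (by positivity) two_pos]
    have h1 : ((A.image red).card : ℝ) ≤ Fintype.card (Fin d → ZMod n) := by
      exact_mod_cast Finset.card_le_univ _
    rw [hcard, hG] at h1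
    linarith
  have hlogG : Real.log G = d * Real.log (8 * d ^ 2) := by
    rw [hGdef, Real.log_pow, hn]; push_cast; rfl
  set T : ℝ := d * Real.log (8 * d ^ 2) + k * Real.log 2 with hT
  have hT0 : 0 ≤ T := by
    have h1 : (1 : ℝ) ≤ 8 * d ^ 2 := by exact_mod_cast hn0
    have := Real.log_nonneg h1
    have := Real.log_nonneg one_le_two
    positivity
  set N : ℕ := ⌊T / α⌋₊ + 1 with hN
  have hN1 : T < N * α := by
    rw [← div_lt_iff₀ hα0, hN]; push_cast
    exact Nat.lt_floor_add_one _
  have hN2 : N * α ≤ T + 1 / 2 := by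
    have h1 : (N : ℝ) ≤ T / α + 1 := by
      rw [hN]; push_cast
      linarith [Nat.floor_le (div_nonneg hT0 hα0.le)]
    have h2 := mul_le_mul_of_nonneg_right h1 hα0.le
    rw [add_mul, div_mul_cancel₀ _ hα0.ne'] at h2
    linarith
  obtain ⟨g, hg⟩ := exists_translates_kFold_cover (A.image red) N k (by
    rw [hcard, hG, hlogG]; exact hN1)
  have hcov := isKFoldCovering_of_torus_cover (n := n) (k := k) b q (A : Set (Fin d → ℤ))
    (fun z hz => (hAP z).1 hz) (fun j i => ((g j i).val : ℤ)) (by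
      intro h
      refine ⟨_, hg (red h), fun j hj => ?_⟩
      simp only [Finset.mem_filter, Finset.mem_univ, true_and, Finset.mem_image] at hj
      obtain ⟨z, hz, hzj⟩ := hj
      refine ⟨z, hz, fun i => ?_⟩
      rw [← ZMod.intCast_zmod_eq_zero_iff_dvd]
      have := congrFun hzj i
      simp only [hred, Pi.sub_apply] at this
      push_cast
      rw [this, ZMod.natCast_zmod_val]
      ring)
  set r : ℝˣ := Units.mk0 (n : ℝ) (by positivity) with hr
  have hbr : ∀ i, (b.unitsSMul fun _ => r) i = (n : ℝ) • b i := fun i => by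
    rw [Module.Basis.unitsSMul_apply]; rfl
  have hdens := translatesDensity_le_of_periodic hc (b.unitsSMul fun _ => r)
    fun j : Fin N => ∑ i, (((g j i).val : ℤ) : ℝ) • b i
  simp only [hbr] at hdens
  have hle : kFoldCoveringDensity k K ≤ _ := sInf_le ⟨_, _, hcov, rfl⟩
  refine hle.trans (hdens.trans ?_)
  rw [volume_fundamentalDomain_unitsSMul_const b r (by simpa [hr] using hn0)]
  have hrG : (r : ℝ) ^ d = G := rfl
  rw [hrG]
  refine ENNReal.div_le_of_le_mul ?_
  have hreal : (N : ℝ) * (2 * A.card) ≤ (4 * T + 2) * G := by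
    have h1 : (N : ℝ) * (2 * A.card) = 4 * (N * α) * G := by
      rw [hα]; field_simp; ring
    rw [h1]
    exact mul_le_mul_of_nonneg_right (by linarith) hGpos.le
  calc (N : ℝ≥0∞) * volume K
      ≤ N * (2 * A.card * volume (ZSpan.fundamentalDomain b)) := by gcongr
    _ = ENNReal.ofReal ((N : ℝ) * (2 * A.card)) * volume (ZSpan.fundamentalDomain b) := by
        rw [ENNReal.ofReal_mul (by positivity), ENNReal.ofReal_mul (by positivity)]
        simp [mul_assoc]
    _ ≤ ENNReal.ofReal ((4 * T + 2) * G) * volume (ZSpan.fundamentalDomain b) := by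
        gcongr
    _ = _ := by rw [ENNReal.ofReal_mul (by positivity), mul_assoc]

theorem theorem3 (d : ℕ) (hd : 2 ≤ d) (K : ConvexBody (EuclideanSpace ℝ (Fin d)))
    (hK : (interior (K : Set (EuclideanSpace ℝ (Fin d)))).Nonempty)
    (k : ℕ) (hk : 1 ≤ k)
    (hkd : (k : ℝ) ≤ (d : ℝ) * (Real.log d + Real.log (Real.log d))) :
    kFoldCoveringDensity k (K : Set (EuclideanSpace ℝ (Fin d))) ≤
      ENNReal.ofReal
        (6 * Real.exp 1 * d * (3 * Real.log d + Real.log (Real.log d) + 15)) := by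
  refine (kFoldCoveringDensity_le_log_card_torus (by omega) K.isCompact K.convex hK k).trans
    (ENNReal.ofReal_le_ofReal ?_)
  have hd2 : (2 : ℝ) ≤ d := by exact_mod_cast hd
  have hk1 : (1 : ℝ) ≤ k := by exact_mod_cast hk
  set L := Real.log d
  set M := Real.log L
  have hL : 0 < L := Real.log_pos (by linarith)
  have hLM : 0 < L + M := by
    by_contra! h
    nlinarith
  have hlog : Real.log (8 * d ^ 2) = 3 * Real.log 2 + 2 * L := by
    rw [Real.log_mul (by norm_num) (by positivity), Real.log_pow,
      show (8 : ℝ) = 2 ^ 3 by norm_num, Real.log_pow]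
    push_cast; rfl
  have hlog2 : Real.log 2 ≤ 1 := by linarith [Real.log_two_lt_d9]
  have hlog2' : 0 < Real.log 2 := Real.log_pos one_lt_two
  have he : (2 : ℝ) ≤ Real.exp 1 := by linarith [Real.exp_one_gt_d9]
  have h1 : k * Real.log 2 ≤ d * (L + M) :=
    (mul_le_of_le_one_right (by linarith) hlog2).trans hkd
  have h2 : d * Real.log (8 * d ^ 2) ≤ d * (3 + 2 * L) := by
    rw [hlog]; gcongr; linarith
  have h3 : 6 * 2 * d * (3 * L + M + 15) ≤ 6 * Real.exp 1 * d * (3 * L + M + 15) := by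
    gcongr
    linarith
  refine le_trans ?_ h3
  have h4 : 0 ≤ d * (L + M) := by positivity
  have h5 : 0 ≤ d * L := by positivity
  nlinarith
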